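/- Let $n\ge 1$. A weight is a locally integrable function $w$ on $\mathbb{R}^n$ that is positive (a.e.); cubes have sides parallel to the coordinate axes and positive side length. For a cube $Q$ put $$\|f\|_{L(LogL)(Q,\frac{dx}{|Q|})}=\inf\Big\{r>0:\ \frac1{|Q|}\int_Q\frac{|f(y)|}{r}\log\Big(e+\frac{|f(y)|}{r}\Big)dy\le 1\Big\}\in[0,\infty].$$ A weight $w$ belongs to $RH_{LLogL}$ if there is $C>0$ such that $\|w\|_{L(LogL)(Q,\frac{dx}{|Q|})}\le C\,\frac1{|Q|}\int_Q w\,dx$ for all cubes $Q$; $\|w\|_{RH_{LLogL}}$ is the infimum of such $C$ ($\infty$ if there are none). For a cube $Q$, $f\in L^1(Q)$ and $t>0$, let $$K(t,f;L^1(Q),L^\infty(Q))=\inf\{\|x_0\|_{L^1(Q)}+t\|x_1\|_{L^\infty(Q)}:\ f=x_0+x_1\}.$$ $f$ belongs to $RH_{0,1}(L^1(Q),L^\infty(Q))$ if there is $C>0$ such that, for all $0<t<|Q|$, $$\int_0^tK(s,f;L^1(Q),L^\infty(Q))\,\frac{ds}{s}\le C\,K(t,f;L^1(Q),L^\infty(Q));$$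 $\|f\|_{RH_{0,1}(L^1(Q),L^\infty(Q))}$ is the infimum of such $C$ ($\infty$ if there are none). Here $|Q|$ is the norm of the embedding $L^\infty(Q)\subset L^1(Q)$. **Theorem.** A weight $w$ belongs to $RH_{LLogL}$ if and only if, for all cubes $Q$, the restriction $w\chi_Q$ belongs to $RH_{0,1}(L^1(Q),L^\infty(Q))$, and $\sup_Q\|w\chi_Q\|_{RH_{0,1}(L^1(Q),L^\infty(Q))}<\infty$. Moreover, there are constants $c_1,c_2>0$, depending only on $n$, such that for every weight $w$ $$\sup_Q\|w\chi_Q\|_{RH_{0,1}(L^1(Q),L^\infty(Q))}\le c_1\|w\|_{RH_{LLogL}},\qquad \|w\|_{RH_{LLogL}}\le c_2\sup_Q\|w\chi_Q\|_{RH_{0,1}(L^1(Q),L^\infty(Q))}.$$ -/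

import Mathlib

open MeasureTheory Set
open scoped ENNReal

noncomputable section

namespace RHLimit

/-! ### The K-functional and the class `RH_{0,1}` of an ordered pair

An ordered pair `X₁ ⊂ X₀` of Banach spaces is given by the continuous embedding `ι : X₁ →L[ℝ] X₀`.
Then `X₀ + X₁ = X₀`, and the norm of the embedding is the operator norm `‖ι‖`. -/

section OrderedPair

variable {X₀ X₁ : Type*} [NormedAddCommGroup X₀] [NormedSpace ℝ X₀]
  [NormedAddCommGroup X₁] [NormedSpace ℝ X₁]

/-- `K(t, w; X₀, X₁) = inf {‖x₀‖_{X₀} + t ‖x₁‖_{X₁} : w = x₀ + x₁, x₀ ∈ X₀, x₁ ∈ X₁}`. -/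
def KFun (ι : X₁ →L[ℝ] X₀) (t : ℝ) (w : X₀) : ℝ :=
  sInf {r : ℝ | ∃ (x₀ : X₀) (x₁ : X₁), w = x₀ + ι x₁ ∧ r = ‖x₀‖ + t * ‖x₁‖}

/-- `C > 0` and `∫_0^t K(s, w; X₀, X₁) ds/s ≤ C K(t, w; X₀, X₁)` for all `0 < t < ‖ι‖`.
The integral is taken in `[0, ∞]`, so that the inequality includes its convergence. -/
def IsRH01Const (ι : X₁ →L[ℝ] X₀) (w : X₀) (C : ℝ) : Prop :=
  0 < C ∧ ∀ t : ℝ, 0 < t → t < ‖ι‖ →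
    ∫⁻ s in Ioo 0 t, ENNReal.ofReal (KFun ι s w / s) ≤ ENNReal.ofReal (C * KFun ι t w)

/-- `w` belongs to `RH_{0,1}(X₀, X₁)`. -/
def MemRH01 (ι : X₁ →L[ℝ] X₀) (w : X₀) : Prop :=
  ∃ C : ℝ, IsRH01Const ι w C

/-- `‖w‖_{RH_{0,1}(X₀, X₁)}`, the infimum of the admissible constants (`∞` if there are none). -/
def normRH01 (ι : X₁ →L[ℝ] X₀) (w : X₀) : ℝ≥0∞ :=
  ⨅ (C : ℝ) (_ : IsRH01Const ι w C), ENNReal.ofReal C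

end OrderedPair

/-! ### The ordered pair `(L¹(μ), L^∞(μ))` of a finite measure -/

section Embedding

variable {α : Type*} [MeasurableSpace α] (μ : Measure α) [IsFiniteMeasure μ]

theorem norm_inclusion_le (f : Lp ℝ ∞ μ) :
    ‖(AddSubgroup.inclusion (Lp.antitone (E := ℝ) (μ := μ) (le_top : (1 : ℝ≥0∞) ≤ ∞)) f :
      Lp ℝ 1 μ)‖ ≤ μ.real univ * ‖f‖ := by
  have h := eLpNorm_le_eLpNorm_mul_rpow_measure_univ (μ := μ) (p := 1) (q := ∞) le_top
    (Lp.aestronglyMeasurable f)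
  rw [Lp.norm_def, Lp.norm_def]
  have h2 := ENNReal.toReal_mono (ENNReal.mul_ne_top (Lp.eLpNorm_ne_top f) (by simp)) h
  simp only [ENNReal.toReal_mul] at h2
  calc _ ≤ _ := h2
    _ = _ := by simp [Measure.real, mul_comm]

/-- The embedding `L^∞(μ) ⊂ L¹(μ)`, `f ↦ f`. -/
def linftyToL1 : Lp ℝ ∞ μ →L[ℝ] Lp ℝ 1 μ :=
  LinearMap.mkContinuous
    { toFun := AddSubgroup.inclusion (Lp.antitone (E := ℝ) (μ := μ) (le_top : (1 : ℝ≥0∞) ≤ ∞))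
      map_add' := fun f g => map_add _ f g
      map_smul' := fun _ _ => rfl }
    (μ.real univ) (norm_inclusion_le μ)

theorem coe_linftyToL1 (f : Lp ℝ ∞ μ) : ((linftyToL1 μ f : Lp ℝ 1 μ) : α →ₘ[μ] ℝ) = f := rfl

theorem linftyToL1_injective : Function.Injective (linftyToL1 μ) :=
  AddSubgroup.inclusion_injective (Lp.antitone (E := ℝ) (μ := μ) (le_top : (1 : ℝ≥0∞) ≤ ∞))

/-- The norm of the embedding `L^∞(μ) ⊂ L¹(μ)` is the total mass of `μ`. -/
theorem norm_linftyToL1 : ‖linftyToL1 μ‖ = μ.real univ := by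
  apply le_antisymm
  · exact LinearMap.mkContinuous_norm_le _ measureReal_nonneg _
  · rcases eq_or_ne μ 0 with rfl | hμ
    · simp
    · have hμ' : μ univ ≠ 0 := by simpa using hμ
      have h1 : MemLp (fun _ : α => (1 : ℝ)) ∞ μ := memLp_const 1
      have h := (linftyToL1 μ).le_opNorm (h1.toLp _)
      have e1 : ‖h1.toLp (fun _ : α => (1 : ℝ))‖ = 1 := by
        rw [Lp.norm_toLp, eLpNorm_const _ (by simp) (by simpa using hμ)]
        simp
      have e2 : ‖linftyToL1 μ (h1.toLp (fun _ : α => (1 : ℝ)))‖ = μ.real univ := by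
        have : linftyToL1 μ (h1.toLp (fun _ : α => (1 : ℝ)))
            = (memLp_const (1 : ℝ) : MemLp (fun _ : α => (1 : ℝ)) 1 μ).toLp _ := rfl
        rw [this, Lp.norm_toLp, eLpNorm_const _ (by simp) (by simpa using hμ)]
        simp [Measure.real]
      rw [e1, e2] at h
      simpa using h

end Embedding

/-! ### Cubes, weights and the class `RH_{LLogL}` -/

/-- A cube in `ℝⁿ` with sides parallel to the coordinate axes: a lower corner `a` and a side length
`ℓ > 0`. -/
structure Cube (n : ℕ) where
  corner : Fin n → ℝ
  side : ℝ
  side_pos : 0 < side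

/-- The points `x` of the cube: `a i ≤ x i ≤ a i + ℓ` for all `i`. -/
def Cube.toSet {n : ℕ} (Q : Cube n) : Set (Fin n → ℝ) :=
  Icc Q.corner (fun i => Q.corner i + Q.side)

/-- Lebesgue measure on the cube `Q`. -/
abbrev Cube.vol {n : ℕ} (Q : Cube n) : Measure (Fin n → ℝ) :=
  volume.restrict Q.toSet

instance {n : ℕ} (Q : Cube n) : IsFiniteMeasure Q.vol :=
  ⟨by rw [Measure.restrict_apply_univ]; exact isCompact_Icc.measure_lt_top⟩

/-- A weight: a locally integrable function on `ℝⁿ` that is positive (almost everywhere). -/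
structure Weight (n : ℕ) where
  toFun : (Fin n → ℝ) → ℝ
  locallyIntegrable : LocallyIntegrable toFun volume
  pos : ∀ᵐ x, 0 < toFun x

variable {n : ℕ}

/-- The norm of the embedding `L^∞(Q) ⊂ L¹(Q)` is `|Q|`. -/
theorem norm_linftyToL1_cube (Q : Cube n) : ‖linftyToL1 Q.vol‖ = volume.real Q.toSet := by
  rw [norm_linftyToL1, measureReal_restrict_apply_univ]

theorem Weight.integrable_cube (w : Weight n) (Q : Cube n) : Integrable w.toFun Q.vol :=
  w.locallyIntegrable.integrableOn_isCompact isCompact_Icc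

/-- `w χ_Q`, the restriction of the weight `w` to the cube `Q`, as an element of `L¹(Q)`. -/
def Weight.restrict (w : Weight n) (Q : Cube n) : Lp ℝ 1 Q.vol :=
  (w.integrable_cube Q).toL1 w.toFun

/-- The Luxemburg norm
`‖f‖_{L(LogL)(Q, dx/|Q|)} = inf {r > 0 : (1/|Q|) ∫_Q (|f|/r) log(e + |f|/r) dy ≤ 1}`,
with values in `[0, ∞]`. -/
def luxLLogL (f : (Fin n → ℝ) → ℝ) (Q : Cube n) : ℝ≥0∞ :=
  ⨅ (r : ℝ) (_ : 0 < r ∧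
    (volume Q.toSet)⁻¹ *
      ∫⁻ y in Q.toSet, ENNReal.ofReal (|f y| / r * Real.log (Real.exp 1 + |f y| / r)) ≤ 1),
    ENNReal.ofReal r

/-- `C > 0` and `‖w‖_{L(LogL)(Q, dx/|Q|)} ≤ C (1/|Q|) ∫_Q w` for all cubes `Q`. -/
def IsRHLLogLConst (w : Weight n) (C : ℝ) : Prop :=
  0 < C ∧ ∀ Q : Cube n,
    luxLLogL w.toFun Q ≤
      ENNReal.ofReal (C * ((volume.real Q.toSet)⁻¹ * ∫ x in Q.toSet, w.toFun x))

/-- `w` belongs to the reverse Hölder class `RH_{LLogL}`. -/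
def MemRHLLogL (w : Weight n) : Prop :=
  ∃ C : ℝ, IsRHLLogLConst w C

/-- `‖w‖_{RH_{LLogL}}`, the infimum of the admissible constants (`∞` if there are none). -/
def normRHLLogL (w : Weight n) : ℝ≥0∞ :=
  ⨅ (C : ℝ) (_ : IsRHLLogLConst w C), ENNReal.ofReal C

/-- `sup_Q ‖w χ_Q‖_{RH_{0,1}(L¹(Q), L^∞(Q))}`, the supremum over all cubes. -/
def supNormRH01 (w : Weight n) : ℝ≥0∞ :=
  ⨆ Q : Cube n, normRH01 (linftyToL1 Q.vol) (w.restrict Q)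

end RHLimit

end

noncomputable section

namespace RHLimit

/-! ### Elementary properties of the K-functional -/

section KFunctional

variable {X₀ X₁ : Type*} [NormedAddCommGroup X₀] [NormedSpace ℝ X₀]
  [NormedAddCommGroup X₁] [NormedSpace ℝ X₁] {ι : X₁ →L[ℝ] X₀} {s t : ℝ} {w : X₀}

/-! For `f ≥ 0` on a finite measure space, the integral of `K(s, f) / s` over `(0, t)` behaves like
an integral of `f log⁺(f / c)`. From below (`le_lintegral_KFun`): by Chebyshev `{f > A / s}`, with
`A = ∫ f`, has measure at most `s`, so `K(s, f)` dominates the integral of `f` over it, and Tonelli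
produces `∫ f log⁺(t f / A)`. From above (`lintegral_KFun_le`): truncating `f` at height `c √(t /
s)` gives the bound `2 c t + 2 ∫ f log⁺(f / c)`.

The lower bound at `t = |Q| / 2`, together with `K(t) ≤ ∫_Q w`, controls the logarithmic integral by
the mass of `w`, hence the Luxemburg norm by the average.

Conversely, take `c = 4 K(t) / t` in the upper bound. As `t < |Q|`, this height is at least the
average of `w` over `Q`, so a Calderón–Zygmund decomposition at height `c` is available. Off the
union `Ω` of the selected cubes `w ≤ c` a.e. and the logarithm vanishes. On each selected cube the
average lies between `c` and `2 ^ n c`, so `RH_{LLogL}` on that cube bounds its logarithmic integral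
by a multiple of its mass (`lintegral_mul_posLog_le`). Summing leaves `∫_Ω w`, and a nearly optimal
decomposition of `w` for `K(t)` shows `|Ω| ≤ t` and therefore `∫_Ω w ≤ 4 K(t)`. -/

theorem KFun_set_nonempty (ι : X₁ →L[ℝ] X₀) (t : ℝ) (w : X₀) :
    {r : ℝ | ∃ (x₀ : X₀) (x₁ : X₁), w = x₀ + ι x₁ ∧ r = ‖x₀‖ + t * ‖x₁‖}.Nonempty :=
  ⟨_, w, 0, by simp, rfl⟩

theorem KFun_le (ht : 0 ≤ t) {x₀ : X₀} {x₁ : X₁} (h : w = x₀ + ι x₁) :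
    KFun ι t w ≤ ‖x₀‖ + t * ‖x₁‖ := by
  refine csInf_le ⟨0, ?_⟩ ⟨x₀, x₁, h, rfl⟩
  rintro _ ⟨x₀, x₁, -, rfl⟩
  positivity

theorem le_KFun {b : ℝ} (h : ∀ (x₀ : X₀) (x₁ : X₁), w = x₀ + ι x₁ → b ≤ ‖x₀‖ + t * ‖x₁‖) :
    b ≤ KFun ι t w := by
  refine le_csInf (KFun_set_nonempty ι t w) ?_
  rintro _ ⟨x₀, x₁, hw, rfl⟩
  exact h x₀ x₁ hw

theorem KFun_nonneg (ht : 0 ≤ t) : 0 ≤ KFun ι t w :=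
  le_KFun fun _ _ _ => by positivity

theorem KFun_le_norm (ht : 0 ≤ t) : KFun ι t w ≤ ‖w‖ := by
  simpa using KFun_le (ι := ι) (x₀ := w) (x₁ := 0) ht (by simp)

theorem exists_decomposition_lt {b : ℝ} (h : KFun ι t w < b) :
    ∃ (x₀ : X₀) (x₁ : X₁), w = x₀ + ι x₁ ∧ ‖x₀‖ + t * ‖x₁‖ < b := by
  obtain ⟨_, ⟨x₀, x₁, hw, rfl⟩, hlt⟩ := exists_lt_of_csInf_lt (KFun_set_nonempty ι t w) h
  exact ⟨x₀, x₁, hw, hlt⟩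

/-- `K(s, w) / s` is nonincreasing in `s`. -/
theorem KFun_div_le_KFun_div (hs : 0 < s) (hst : s ≤ t) :
    KFun ι t w / t ≤ KFun ι s w / s := by
  have ht : 0 < t := hs.trans_le hst
  rw [le_div_iff₀ hs]
  refine le_KFun fun x₀ x₁ h => ?_
  calc KFun ι t w / t * s ≤ (‖x₀‖ + t * ‖x₁‖) / t * s := by
        gcongr; exact KFun_le ht.le h
    _ = s / t * ‖x₀‖ + s * ‖x₁‖ := by field_simp
    _ ≤ 1 * ‖x₀‖ + s * ‖x₁‖ := by
        gcongr; exact (div_le_one ht).2 hst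
    _ = _ := by ring

/-- Since `K(s) / s ≥ K(t) / t` for `s < t`, the integral over `(0, t)` is at least `K(t)`. The
bound serves to absorb additive constants into `C`. -/
theorem one_le_of_isRH01Const {C : ℝ} (hC : IsRH01Const ι w C) (ht : 0 < t) (htι : t < ‖ι‖)
    (hK : 0 < KFun ι t w) : 1 ≤ C := by
  have h := hC.2 t ht htι
  have h1 : ENNReal.ofReal (KFun ι t w) ≤
      ∫⁻ s in Ioo 0 t, ENNReal.ofReal (KFun ι s w / s) := by
    calc ENNReal.ofReal (KFun ι t w) = ∫⁻ _ in Ioo 0 t, ENNReal.ofReal (KFun ι t w / t) := by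
          rw [setLIntegral_const, Real.volume_Ioo, sub_zero, ← ENNReal.ofReal_mul (by positivity),
            div_mul_cancel₀ _ ht.ne']
      _ ≤ _ := setLIntegral_mono' measurableSet_Ioo fun s hs =>
          ENNReal.ofReal_le_ofReal (KFun_div_le_KFun_div hs.1 hs.2.le)
  have h2 := (ENNReal.ofReal_le_ofReal_iff (mul_nonneg hC.1.le hK.le)).1 (h1.trans h)
  exact le_of_mul_le_mul_right (by simpa using h2) hK

theorem IsRH01Const.mono {C D : ℝ} (hC : IsRH01Const ι w C) (hCD : C ≤ D) :
    IsRH01Const ι w D :=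
  ⟨hC.1.trans_le hCD, fun t ht htι => (hC.2 t ht htι).trans
    (ENNReal.ofReal_le_ofReal (mul_le_mul_of_nonneg_right hCD (KFun_nonneg ht.le)))⟩

end KFunctional

/-! ### The K-functional of `(L¹, L^∞)` on a finite measure space -/

section L1Linfty

variable {α : Type*} [MeasurableSpace α] {μ : Measure α} {f : α → ℝ}

theorem norm_toL1_eq_integral (hf : Integrable f μ) (h0 : 0 ≤ᵐ[μ] f) :
    ‖hf.toL1 f‖ = ∫ x, f x ∂μ := by
  rw [L1.norm_of_fun_eq_integral_norm]
  refine integral_congr_ae ?_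
  filter_upwards [h0] with x hx
  exact Real.norm_of_nonneg hx

variable [IsFiniteMeasure μ]

/-- The decomposition of `f` by truncation at height `c`. -/
theorem KFun_le_truncation (hf : Integrable f μ) (h0 : 0 ≤ᵐ[μ] f) {c t : ℝ} (hc : 0 ≤ c)
    (ht : 0 ≤ t) :
    KFun (linftyToL1 μ) t (hf.toL1 f) ≤ ∫ x, max (f x - c) 0 ∂μ + t * c := by
  have hm : MemLp (fun x => min (f x) c) ∞ μ := by
    refine memLp_top_of_bound (hf.1.inf aestronglyMeasurable_const) c ?_
    filter_upwards [h0] with x hx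
    rw [Real.norm_of_nonneg (le_min hx hc)]
    exact min_le_right _ _
  have hp : Integrable (fun x => max (f x - c) 0) μ :=
    (hf.sub (integrable_const c)).pos_part
  have hdec : hf.toL1 f = hp.toL1 _ + linftyToL1 μ (hm.toLp _) := by
    have e : linftyToL1 μ (hm.toLp _) = (hm.mono_exponent le_top).toLp _ := rfl
    rw [e]
    refine (Integrable.toL1_eq_toL1_iff _ _ hf (hp.add (memLp_one_iff_integrable.1
      (hm.mono_exponent le_top)))).2 ?_
    filter_upwards with x
    simp only [Pi.add_apply]
    rcases le_total (f x) c with h | h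
    · rw [min_eq_left h, max_eq_right (by linarith)]; ring
    · rw [min_eq_right h, max_eq_left (by linarith)]; ring
  refine (KFun_le ht hdec).trans ?_
  gcongr
  · rw [norm_toL1_eq_integral hp (ae_of_all _ fun x => le_max_right _ _)]
  · rw [Lp.norm_toLp]
    refine ENNReal.toReal_le_of_le_ofReal hc ?_
    rw [eLpNorm_exponent_top]
    refine eLpNormEssSup_le_of_ae_bound ?_
    filter_upwards [h0] with x hx
    rw [Real.norm_of_nonneg (le_min hx hc)]
    exact min_le_right _ _

/-- Kept for one fixed decomposition and an arbitrary `E`: it is later applied to a set whose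
measure is not yet known to be at most `t`. -/
theorem setIntegral_le_of_decomposition (hf : Integrable f μ) {x₀ : Lp ℝ 1 μ} {x₁ : Lp ℝ ∞ μ}
    (h : hf.toL1 f = x₀ + linftyToL1 μ x₁) (E : Set α) :
    ∫ x in E, f x ∂μ ≤ ‖x₀‖ + ‖x₁‖ * μ.real E := by
  have hi₀ : Integrable x₀ μ := L1.integrable_coeFn x₀
  have hfe : f =ᵐ[μ] fun x => x₀ x + x₁ x := by
    have e := hf.coeFn_toL1
    rw [h] at e
    have e₁ : ((linftyToL1 μ x₁ : Lp ℝ 1 μ) : α → ℝ) = x₁ := rfl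
    filter_upwards [e, Lp.coeFn_add x₀ (linftyToL1 μ x₁)] with x hx hx'
    rw [← hx, hx', Pi.add_apply, e₁]
  have hb : ∀ᵐ x ∂μ, ‖x₁ x‖ ≤ ‖x₁‖ := by
    have := ae_le_eLpNormEssSup (f := x₁) (μ := μ)
    filter_upwards [this] with x hx
    rw [Lp.norm_def, ← toReal_enorm]
    refine ENNReal.toReal_mono (Lp.eLpNorm_ne_top x₁) ?_
    rwa [eLpNorm_exponent_top]
  have hle : ∀ᵐ x ∂μ, f x ≤ ‖x₀ x‖ + ‖x₁‖ := by
    filter_upwards [hfe, hb] with x hx hx'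
    rw [hx]
    exact add_le_add (Real.le_norm_self _) ((Real.le_norm_self _).trans hx')
  calc ∫ x in E, f x ∂μ ≤ ∫ x in E, (‖x₀ x‖ + ‖x₁‖) ∂μ :=
        integral_mono_ae hf.integrableOn (hi₀.norm.integrableOn.add (integrable_const _))
          (ae_restrict_of_ae hle)
    _ = ∫ x in E, ‖x₀ x‖ ∂μ + ‖x₁‖ * μ.real E := by
        rw [integral_add hi₀.norm.integrableOn (integrable_const _)]
        simp [mul_comm]
    _ ≤ ‖x₀‖ + ‖x₁‖ * μ.real E := by
        gcongr
        rw [L1.norm_eq_integral_norm]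
        exact setIntegral_le_integral hi₀.norm (ae_of_all _ fun x => norm_nonneg _)

theorem setIntegral_le_KFun (hf : Integrable f μ) {t : ℝ} {E : Set α} (hE : μ.real E ≤ t) :
    ∫ x in E, f x ∂μ ≤ KFun (linftyToL1 μ) t (hf.toL1 f) := by
  refine le_KFun fun x₀ x₁ h => (setIntegral_le_of_decomposition hf h E).trans ?_
  rw [mul_comm t]
  gcongr

/-- Compare `K(t) / t` with its value at the total mass, where `K` is at least the full integral. It
says that the average of `f` is at most `K(t) / t`. -/
theorem mul_integral_le_KFun (hf : Integrable f μ) {t : ℝ} (ht : 0 ≤ t)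
    (htμ : t ≤ μ.real univ) :
    t * ∫ x, f x ∂μ ≤ μ.real univ * KFun (linftyToL1 μ) t (hf.toL1 f) := by
  rcases ht.eq_or_lt with rfl | ht'
  · rw [zero_mul]; exact mul_nonneg measureReal_nonneg (KFun_nonneg le_rfl)
  have h := KFun_div_le_KFun_div (ι := linftyToL1 μ) (w := hf.toL1 f) ht' htμ
  have h1 := setIntegral_le_KFun hf (E := univ) le_rfl
  rw [div_le_div_iff₀ (ht'.trans_le htμ) ht'] at h
  rw [setIntegral_univ] at h1
  nlinarith

/-! ### Integrals of `K(s) / s` against logarithmic integrals -/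

open Real (log posLog)

theorem lintegral_div_Ioc {a b x : ℝ} (ha : 0 < a) (hab : a ≤ b) (hx : 0 ≤ x) :
    ∫⁻ s in Ioc a b, ENNReal.ofReal (x / s) = ENNReal.ofReal (x * log (b / a)) := by
  have hb : 0 < b := ha.trans_le hab
  have hi : IntervalIntegrable (fun s : ℝ => x / s) volume a b := by
    refine ContinuousOn.intervalIntegrable (continuousOn_const.div continuousOn_id ?_)
    intro s hs
    rw [uIcc_of_le hab] at hs
    exact (ha.trans_le hs.1).ne'
  rw [← ofReal_integral_eq_lintegral_ofReal]
  · rw [← intervalIntegral.integral_of_le hab]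
    simp_rw [div_eq_mul_inv x]
    rw [intervalIntegral.integral_const_mul, integral_inv_of_pos ha hb]
  · exact (intervalIntegrable_iff_integrableOn_Ioc_of_le hab).1 hi
  · filter_upwards [ae_restrict_mem measurableSet_Ioc] with s hs
    exact div_nonneg hx (ha.trans hs.1).le

/-- A truncation height growing like `s ^ (-1/2)` exceeds any fixed value `x` for small `s`, so only
a logarithmic range of `s` contributes; yet the height itself remains integrable near `0`. -/
theorem lintegral_truncation_le {x c t : ℝ} (hx : 0 ≤ x) (hc : 0 < c) (ht : 0 < t) :
    ∫⁻ s in Ioo 0 t, ENNReal.ofReal (max (x - c * √(t / s)) 0 / s) ≤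
      ENNReal.ofReal (2 * (x * posLog (x / c))) := by
  rcases le_or_gt x c with hxc | hxc
  · refine le_of_eq_of_le ?_ zero_le
    refine (setLIntegral_congr_fun measurableSet_Ioo fun s hs => ?_).trans lintegral_zero
    have h1 : 1 ≤ √(t / s) := Real.one_le_sqrt.2 ((one_le_div hs.1).2 hs.2.le)
    have h2 : x - c * √(t / s) ≤ 0 := by nlinarith
    simp [max_eq_right h2]
  have hx0 : 0 < x := hc.trans hxc
  set a := t * (c / x) ^ 2 with ha
  have ha0 : 0 < a := by positivity
  have hat : a ≤ t := by
    have : (c / x) ^ 2 ≤ 1 := pow_le_one₀ (by positivity) ((div_le_one hx0).2 hxc.le)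
    nlinarith
  have hlog : log (t / a) = 2 * posLog (x / c) := by
    rw [Real.posLog_eq_log (by rw [abs_of_pos (by positivity)]; exact (one_le_div hc).2 hxc.le)]
    have : t / a = (x / c) ^ 2 := by rw [ha]; field_simp
    rw [this, Real.log_pow]; norm_num
  calc ∫⁻ s in Ioo 0 t, ENNReal.ofReal (max (x - c * √(t / s)) 0 / s)
      ≤ ∫⁻ s in Ioo 0 t, (Ioc a t).indicator (fun s => ENNReal.ofReal (x / s)) s := by
        refine setLIntegral_mono' measurableSet_Ioo fun s hs => ?_
        rcases le_or_gt s a with hsa | hsa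
        · have h1 : x / c ≤ √(t / s) := by
            apply Real.le_sqrt_of_sq_le
            rw [le_div_iff₀ hs.1]
            calc (x / c) ^ 2 * s ≤ (x / c) ^ 2 * a := by gcongr
              _ = t := by rw [ha]; field_simp
          have h2 : x - c * √(t / s) ≤ 0 := by
            rw [div_le_iff₀ hc] at h1; linarith
          simp [max_eq_right h2]
        · rw [indicator_of_mem (show s ∈ Ioc a t from ⟨hsa, hs.2.le⟩)]
          refine ENNReal.ofReal_le_ofReal (div_le_div_of_nonneg_right (max_le ?_ hx) hs.1.le)
          have : 0 ≤ c * √(t / s) := by positivity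
          linarith
    _ ≤ ∫⁻ s, (Ioc a t).indicator (fun s => ENNReal.ofReal (x / s)) s := setLIntegral_le_lintegral _ _
    _ = _ := by
        rw [lintegral_indicator measurableSet_Ioc, lintegral_div_Ioc ha0 hat hx, hlog]
        congr 1; ring

/-- The level condition means `s > A / x`, and `1 / s` integrates over `(A / x, t)` to the
logarithm. -/
theorem le_lintegral_level {x A t : ℝ} (hx : 0 ≤ x) (hA : 0 < A) (ht : 0 < t) :
    ENNReal.ofReal (x * posLog (t * x / A)) ≤
      ∫⁻ s in Ioo 0 t, if A / s < x then ENNReal.ofReal (x / s) else 0 := by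
  rcases le_or_gt (t * x) A with h | h
  · have : posLog (t * x / A) = 0 := by
      rw [Real.posLog_eq_zero_iff, abs_of_nonneg (by positivity)]
      exact (div_le_one hA).2 h
    simp [this]
  have hx0 : 0 < x := by by_contra! h'; nlinarith
  have ha : 0 < A / x := by positivity
  have hat : A / x ≤ t := (div_le_iff₀ hx0).2 h.le
  calc ENNReal.ofReal (x * posLog (t * x / A)) = ENNReal.ofReal (x * log (t / (A / x))) := by
        rw [Real.posLog_eq_log]
        · congr 3; field_simp
        · rw [abs_of_pos (by positivity)]; exact (one_le_div hA).2 h.le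
    _ = ∫⁻ s in Ioc (A / x) t, ENNReal.ofReal (x / s) := (lintegral_div_Ioc ha hat hx).symm
    _ = ∫⁻ s in Ioo (A / x) t, ENNReal.ofReal (x / s) := (setLIntegral_congr Ioo_ae_eq_Ioc).symm
    _ ≤ ∫⁻ s in Ioo (A / x) t, if A / s < x then ENNReal.ofReal (x / s) else 0 := by
        refine setLIntegral_mono' measurableSet_Ioo fun s hs => ?_
        rw [if_pos]
        have := hs.1
        rw [div_lt_iff₀ hx0] at this
        rw [div_lt_iff₀ (ha.trans hs.1)]; linarith
    _ ≤ _ := lintegral_mono_set (Ioo_subset_Ioo_left ha.le)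

theorem lintegral_sqrt_div {t : ℝ} (ht : 0 < t) :
    ∫⁻ s in Ioo 0 t, ENNReal.ofReal (√(t / s)) = ENNReal.ofReal (2 * t) := by
  have e : ∀ s ∈ Ioc 0 t, √(t / s) = √t * s ^ (-(1 / 2) : ℝ) := fun s hs => by
    rw [Real.sqrt_div ht.le, Real.rpow_neg hs.1.le, ← Real.sqrt_eq_rpow]; rfl
  have hi : IntervalIntegrable (fun s : ℝ => √t * s ^ (-(1 / 2) : ℝ)) volume 0 t :=
    (intervalIntegral.intervalIntegrable_rpow' (by norm_num)).const_mul _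
  rw [setLIntegral_congr Ioo_ae_eq_Ioc,
    setLIntegral_congr_fun measurableSet_Ioc fun s hs => by rw [e s hs],
    ← ofReal_integral_eq_lintegral_ofReal, ← intervalIntegral.integral_of_le ht.le,
    intervalIntegral.integral_const_mul, integral_rpow (Or.inl (by norm_num))]
  · congr 1
    have : (-(1 / 2) + 1 : ℝ) = 1 / 2 := by norm_num
    rw [this, Real.zero_rpow (by norm_num), ← Real.sqrt_eq_rpow]
    have := Real.mul_self_sqrt ht.le
    linarith
  · exact (intervalIntegrable_iff_integrableOn_Ioc_of_le ht.le).1 hi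
  · filter_upwards [ae_restrict_mem measurableSet_Ioc] with s hs
    have := hs.1
    simp only [Pi.zero_apply]; positivity

/-- Truncate at the `s`-dependent height `c √(t / s)`: the bounded parts integrate to `2 c t`, and
Tonelli reduces the excess to the pointwise estimate `lintegral_truncation_le`. -/
theorem lintegral_KFun_le (hf : Integrable f μ) (h0 : 0 ≤ᵐ[μ] f) {c t : ℝ} (hc : 0 < c)
    (ht : 0 < t) :
    ∫⁻ s in Ioo 0 t, ENNReal.ofReal (KFun (linftyToL1 μ) s (hf.toL1 f) / s) ≤
      ENNReal.ofReal (2 * c * t) + ∫⁻ x, ENNReal.ofReal (2 * (f x * posLog (f x / c))) ∂μ := by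
  calc ∫⁻ s in Ioo 0 t, ENNReal.ofReal (KFun (linftyToL1 μ) s (hf.toL1 f) / s)
      ≤ ∫⁻ s in Ioo 0 t, (ENNReal.ofReal c * ENNReal.ofReal (√(t / s)) +
          ∫⁻ x, ENNReal.ofReal (max (f x - c * √(t / s)) 0 / s) ∂μ) := by
        refine setLIntegral_mono' measurableSet_Ioo fun s hs => ?_
        have hs0 := hs.1
        have hi : Integrable (fun x => max (f x - c * √(t / s)) 0 / s) μ :=
          ((hf.sub (integrable_const _)).pos_part).div_const _
        rw [← ofReal_integral_eq_lintegral_ofReal hi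
          (ae_of_all _ fun x => div_nonneg (le_max_right _ _) hs0.le), ← ENNReal.ofReal_mul hc.le,
          ← ENNReal.ofReal_add (by positivity)
          (integral_nonneg fun x => div_nonneg (le_max_right _ _) hs0.le)]
        refine ENNReal.ofReal_le_ofReal ?_
        rw [integral_div, div_le_iff₀ hs0, add_mul, div_mul_cancel₀ _ hs0.ne']
        refine (KFun_le_truncation hf h0 (c := c * √(t / s)) (by positivity) hs0.le).trans ?_
        linarith
    _ = ENNReal.ofReal (2 * c * t) +
          ∫⁻ x, (∫⁻ s in Ioo 0 t, ENNReal.ofReal (max (f x - c * √(t / s)) 0 / s)) ∂μ := by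
        rw [lintegral_add_left (by fun_prop), lintegral_const_mul _ (by fun_prop),
          lintegral_sqrt_div ht, ← ENNReal.ofReal_mul hc.le, lintegral_lintegral_swap]
        · congr 2; ring
        · have h1 : AEMeasurable (fun p : ℝ × α => f p.2) ((volume.restrict (Ioo 0 t)).prod μ) :=
            hf.1.aemeasurable.comp_snd
          refine AEMeasurable.ennreal_ofReal ?_
          exact ((h1.sub (by fun_prop)).max aemeasurable_const).div (by fun_prop)
    _ ≤ _ := by
        gcongr 1
        refine lintegral_mono_ae ?_
        filter_upwards [h0] with x hx
        exact lintegral_truncation_le hx hc ht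

theorem le_lintegral_KFun_of_measurable (hm : Measurable f) (hf : Integrable f μ)
    (h0 : 0 ≤ᵐ[μ] f) {t : ℝ} (hA : 0 < ∫ x, f x ∂μ) (ht : 0 < t) :
    ∫⁻ x, ENNReal.ofReal (f x * posLog (t * f x / ∫ y, f y ∂μ)) ∂μ ≤
      ∫⁻ s in Ioo 0 t, ENNReal.ofReal (KFun (linftyToL1 μ) s (hf.toL1 f) / s) := by
  set A := ∫ y, f y ∂μ
  calc ∫⁻ x, ENNReal.ofReal (f x * posLog (t * f x / A)) ∂μ
      ≤ ∫⁻ x, (∫⁻ s in Ioo 0 t, (if A / s < f x then ENNReal.ofReal (f x / s) else 0)) ∂μ := by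
        refine lintegral_mono_ae ?_
        filter_upwards [h0] with x hx
        exact le_lintegral_level hx hA ht
    _ = ∫⁻ s in Ioo 0 t, ∫⁻ x, (if A / s < f x then ENNReal.ofReal (f x / s) else 0) ∂μ := by
        rw [lintegral_lintegral_swap]
        refine (Measurable.ite (measurableSet_lt ?_ ?_) ?_ measurable_const).aemeasurable <;> fun_prop
    _ ≤ _ := by
        refine setLIntegral_mono' measurableSet_Ioo fun s hs => ?_
        have hs0 := hs.1
        set E := {x | A / s < f x} with hEdef
        have hE : MeasurableSet E := measurableSet_lt measurable_const hm
        -- Chebyshev: this is what makes `E` admissible in the lower bound for `K` at the parameter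
        -- `s`.
        have hEs : μ.real E ≤ s := by
          have h1 := mul_meas_ge_le_integral_of_nonneg h0 hf (A / s)
          have h2 : μ.real E ≤ μ.real {x | A / s ≤ f x} :=
            measureReal_mono fun x (hx : A / s < f x) => hx.le
          have h3 : A / s * μ.real E ≤ A := (mul_le_mul_of_nonneg_left h2 (by positivity)).trans h1
          rw [div_mul_eq_mul_div, div_le_iff₀ hs0] at h3
          exact le_of_mul_le_mul_left h3 hA
        calc ∫⁻ x, (if A / s < f x then ENNReal.ofReal (f x / s) else 0) ∂μ
            = ∫⁻ x in E, ENNReal.ofReal (f x / s) ∂μ := by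
              rw [← lintegral_indicator hE]; rfl
          _ = ENNReal.ofReal (∫ x in E, f x / s ∂μ) := by
              rw [ofReal_integral_eq_lintegral_ofReal (hf.div_const s).integrableOn]
              filter_upwards [ae_restrict_of_ae h0] with x hx
              exact div_nonneg hx hs0.le
          _ ≤ _ := by
              rw [integral_div]
              gcongr
              exact setIntegral_le_KFun hf hEs

theorem le_lintegral_KFun (hf : Integrable f μ)
    (h0 : 0 ≤ᵐ[μ] f) {t : ℝ} (hA : 0 < ∫ x, f x ∂μ) (ht : 0 < t) :
    ∫⁻ x, ENNReal.ofReal (f x * posLog (t * f x / ∫ y, f y ∂μ)) ∂μ ≤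
      ∫⁻ s in Ioo 0 t, ENNReal.ofReal (KFun (linftyToL1 μ) s (hf.toL1 f) / s) := by
  obtain ⟨g, hg, hfg⟩ := hf.1.aemeasurable
  have hgi : Integrable g μ := hf.congr hfg
  have hI : ∫ y, f y ∂μ = ∫ y, g y ∂μ := integral_congr_ae hfg
  have hL : hf.toL1 f = hgi.toL1 g := (Integrable.toL1_eq_toL1_iff _ _ _ _).2 hfg
  rw [hL, hI]
  refine le_trans (le_of_eq (lintegral_congr_ae ?_))
    (le_lintegral_KFun_of_measurable hg hgi (h0.trans_eq hfg) (hI ▸ hA) ht)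
  filter_upwards [hfg] with x hx
  rw [hx]

end L1Linfty

/-! ### Dyadic cubes and the Calderón–Zygmund decomposition -/

section CalderonZygmund

open Filter Topology

variable {n : ℕ}

theorem Cube.volume_real (Q : Cube n) : volume.real Q.toSet = Q.side ^ n := by
  rw [Measure.real, Cube.toSet, Real.volume_Icc_pi_toReal]
  · simp
  · intro i
    have := Q.side_pos
    simp only; linarith

theorem Cube.volume_real_pos (Q : Cube n) : 0 < volume.real Q.toSet := by
  rw [Q.volume_real]; exact pow_pos Q.side_pos n

theorem Cube.volume_ne_top (Q : Cube n) : volume Q.toSet ≠ ∞ :=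
  isCompact_Icc.measure_ne_top

theorem Cube.measurableSet (Q : Cube n) : MeasurableSet Q.toSet := measurableSet_Icc

/-- The cube `Q` without its upper faces. -/
def Cube.halfOpen (Q : Cube n) : Set (Fin n → ℝ) :=
  univ.pi fun i => Ico (Q.corner i) (Q.corner i + Q.side)

theorem Cube.halfOpen_ae_eq (Q : Cube n) : Q.halfOpen =ᵐ[volume] Q.toSet :=
  Measure.univ_pi_Ico_ae_eq_Icc

theorem Cube.halfOpen_subset (Q : Cube n) : Q.halfOpen ⊆ Q.toSet := fun _ hx =>
  ⟨fun i => (hx i trivial).1, fun i => (hx i trivial).2.le⟩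

theorem Cube.measurableSet_halfOpen (Q : Cube n) : MeasurableSet Q.halfOpen :=
  MeasurableSet.univ_pi fun _ => measurableSet_Ico

/-- Cubes are balls of the sup norm, the form in which Lebesgue differentiation is applied. -/
theorem Cube.toSet_eq_closedBall (Q : Cube n) :
    Q.toSet = Metric.closedBall (fun i => Q.corner i + Q.side / 2) (Q.side / 2) := by
  rw [closedBall_pi _ (by have := Q.side_pos; positivity), Cube.toSet, ← pi_univ_Icc]
  congr 1; ext1 i
  rw [Real.closedBall_eq_Icc]
  congr 1 <;> ring

/-- The dyadic subcube of generation `k` and position `m` of `Q` (any integral position is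
allowed, so that these cubes tile the space). -/
def dyadicCube (Q : Cube n) (k : ℕ) (m : Fin n → ℤ) : Cube n where
  corner i := Q.corner i + Q.side / 2 ^ k * m i
  side := Q.side / 2 ^ k
  side_pos := div_pos Q.side_pos (by positivity)

/-- The position of the half-open dyadic cube of generation `k` that contains `x`. -/
def dyadicIndex (Q : Cube n) (k : ℕ) (x : Fin n → ℝ) : Fin n → ℤ :=
  fun i => ⌊2 ^ k * ((x i - Q.corner i) / Q.side)⌋

theorem mem_dyadicCube_halfOpen {Q : Cube n} {k : ℕ} {m : Fin n → ℤ} {x : Fin n → ℝ} :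
    x ∈ (dyadicCube Q k m).halfOpen ↔ dyadicIndex Q k x = m := by
  have hs := Q.side_pos
  rw [funext_iff]
  simp only [Cube.halfOpen, mem_univ_pi]
  refine forall_congr' fun i => ?_
  simp only [dyadicCube, dyadicIndex, Int.floor_eq_iff, mem_Ico]
  have e : 2 ^ k * ((x i - Q.corner i) / Q.side) = (x i - Q.corner i) / (Q.side / 2 ^ k) := by
    field_simp
  have hp : 0 < Q.side / 2 ^ k := by positivity
  rw [e, le_div_iff₀ hp, div_lt_iff₀ hp]
  constructor <;> rintro ⟨h1, h2⟩ <;> constructor <;> linarith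

/-- Nesting of dyadic cubes: the index at a coarse generation is the integer quotient of the finer
one by a power of `2`. -/
theorem dyadicIndex_eq_of_le {Q : Cube n} {j k : ℕ} (hjk : j ≤ k) {x y : Fin n → ℝ}
    (h : dyadicIndex Q k x = dyadicIndex Q k y) : dyadicIndex Q j x = dyadicIndex Q j y := by
  have key : ∀ u : ℝ, ⌊2 ^ j * u⌋ = ⌊2 ^ k * u⌋ / ((2 ^ (k - j) : ℕ) : ℤ) := fun u => by
    rw [← Int.floor_div_natCast]
    congr 1
    push_cast
    rw [eq_div_iff (by positivity), mul_right_comm, ← pow_add, Nat.add_sub_cancel' hjk]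
  funext i
  have hi := congrFun h i
  simp only [dyadicIndex] at hi ⊢
  rw [key, key, hi]

theorem dyadicCube_zero (Q : Cube n) : dyadicCube Q 0 0 = Q := by
  cases Q; simp [dyadicCube]

theorem dyadicCube_volume_succ (Q : Cube n) (k : ℕ) (m m' : Fin n → ℤ) :
    volume.real (dyadicCube Q k m).toSet =
      2 ^ n * volume.real (dyadicCube Q (k + 1) m').toSet := by
  rw [Cube.volume_real, Cube.volume_real, ← mul_pow]
  simp only [dyadicCube]
  congr 1
  rw [pow_succ]; field_simp

/-- **Calderón–Zygmund decomposition** of a cube at height `c`. -/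
theorem exists_calderonZygmund {f : (Fin n → ℝ) → ℝ} (hf : LocallyIntegrable f volume)
    (h0 : 0 ≤ᵐ[volume] f) (Q : Cube n) {c : ℝ}
    (hQ : ∫ x in Q.toSet, f x ≤ c * volume.real Q.toSet) :
    ∃ (I : Set (ℕ × (Fin n → ℤ))) (q : I → Cube n),
      (∀ i, (q i).halfOpen ⊆ Q.toSet) ∧
      Pairwise (Function.onFun Disjoint fun i => (q i).halfOpen) ∧
      (∀ i, c * volume.real (q i).toSet < ∫ x in (q i).toSet, f x) ∧
      (∀ i, ∫ x in (q i).toSet, f x ≤ 2 ^ n * c * volume.real (q i).toSet) ∧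
      ∀ᵐ x, x ∈ Q.toSet → x ∉ ⋃ i, (q i).halfOpen → f x ≤ c := by
  classical
  let P : ℕ → (Fin n → ℤ) → Prop := fun k m =>
    c * volume.real (dyadicCube Q k m).toSet < ∫ x in (dyadicCube Q k m).toSet, f x
  have hP0 : ¬ P 0 0 := by
    simp only [P, dyadicCube_zero]; exact hQ.not_gt
  -- Maximal cubes with average above `c`: the witness `x` lies in `Q`, and all strict dyadic
  -- ancestors of the cube have average at most `c`. Requiring `x` in `Q` excludes the rest of the
  -- tiling.
  let I : Set (ℕ × (Fin n → ℤ)) := {p | P p.1 p.2 ∧ ∃ x, dyadicIndex Q 0 x = 0 ∧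
    dyadicIndex Q p.1 x = p.2 ∧ ∀ j < p.1, ¬ P j (dyadicIndex Q j x)}
  refine ⟨I, fun p => dyadicCube Q p.1.1 p.1.2, ?_, ?_, fun p => p.2.1, ?_, ?_⟩
  · rintro ⟨⟨k, m⟩, _, x, hx0, hxm, _⟩ y hy
    replace hy := mem_dyadicCube_halfOpen.1 hy
    refine Q.halfOpen_subset ?_
    rw [← dyadicCube_zero Q, mem_dyadicCube_halfOpen, ← hx0]
    exact dyadicIndex_eq_of_le (Nat.zero_le k) (hy.trans hxm.symm)
  · rintro ⟨⟨k, m⟩, hP, x, hx0, hxm, hx⟩ ⟨⟨k', m'⟩, hP', x', hx0', hxm', hx'⟩ hne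
    refine disjoint_left.2 fun z hz hz' => hne ?_
    simp only [mem_dyadicCube_halfOpen] at hz hz' hP hP' hxm hxm' hx hx'
    have e : ∀ j ≤ k, dyadicIndex Q j x = dyadicIndex Q j z := fun j hj =>
      dyadicIndex_eq_of_le hj (hxm.trans hz.symm)
    have e' : ∀ j ≤ k', dyadicIndex Q j x' = dyadicIndex Q j z := fun j hj =>
      dyadicIndex_eq_of_le hj (hxm'.trans hz'.symm)
    have hk : k = k' := by
      rcases lt_trichotomy k k' with h | h | h
      · exact absurd (hz ▸ hP) (e' k h.le ▸ hx' k h)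
      · exact h
      · exact absurd (hz' ▸ hP') (e k' h.le ▸ hx k' h)
    subst hk
    simp [← hz, ← hz']
  · rintro ⟨⟨k, m⟩, hP, x, hx0, hxm, hx⟩
    simp only at hP hxm hx ⊢
    -- `Q` itself is not selected, so a selected cube has a parent; the parent has small average and
    -- `2 ^ n` times the volume.
    rcases k with _ | j
    · exact absurd (hxm.symm.trans hx0 ▸ hP) hP0
    have h1 := not_lt.1 (hx j (Nat.lt_succ_self j))
    rw [dyadicCube_volume_succ Q j _ m] at h1
    have hsub : (dyadicCube Q (j + 1) m).halfOpen ⊆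
        (dyadicCube Q j (dyadicIndex Q j x)).halfOpen := fun y hy => by
      rw [mem_dyadicCube_halfOpen] at hy ⊢
      exact dyadicIndex_eq_of_le (Nat.le_succ j) (hy.trans hxm.symm)
    calc ∫ y in (dyadicCube Q (j + 1) m).toSet, f y
        = ∫ y in (dyadicCube Q (j + 1) m).halfOpen, f y :=
          (setIntegral_congr_set (Cube.halfOpen_ae_eq _)).symm
      _ ≤ ∫ y in (dyadicCube Q j (dyadicIndex Q j x)).halfOpen, f y := by
          refine setIntegral_mono_set ?_ (ae_restrict_of_ae h0) hsub.eventuallyLE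
          exact (hf.integrableOn_isCompact isCompact_Icc).mono_set (Cube.halfOpen_subset _)
      _ = ∫ y in (dyadicCube Q j (dyadicIndex Q j x)).toSet, f y :=
          setIntegral_congr_set (Cube.halfOpen_ae_eq _)
      _ ≤ _ := h1.trans_eq (by ring)
  · filter_upwards [IsUnifLocDoublingMeasure.ae_tendsto_average volume hf 1,
      Q.halfOpen_ae_eq.mem_iff] with x hx hxQ hxm hxI
    have hx0 : dyadicIndex Q 0 x = 0 := by
      rw [← mem_dyadicCube_halfOpen, dyadicCube_zero]; exact hxQ.2 hxm
    -- Were some dyadic cube containing `x` to have average above `c`, the first such one would be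
    -- selected and contain `x`.
    have hnP : ∀ k, ¬ P k (dyadicIndex Q k x) := fun k hk => by
      have hex : ∃ k, P k (dyadicIndex Q k x) := ⟨k, hk⟩
      refine hxI (mem_iUnion.2 ⟨⟨(Nat.find hex, dyadicIndex Q (Nat.find hex) x),
        Nat.find_spec hex, x, hx0, rfl, fun j hj => Nat.find_min hex hj⟩, ?_⟩)
      exact mem_dyadicCube_halfOpen.2 rfl
    let q : ℕ → Cube n := fun k => dyadicCube Q k (dyadicIndex Q k x)
    have hlim : Tendsto (fun k => (q k).side / 2) atTop (𝓝[>] 0) := by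
      refine tendsto_nhdsWithin_iff.2 ⟨?_, Eventually.of_forall fun k => half_pos (q k).side_pos⟩
      have h1 := (tendsto_pow_atTop_nhds_zero_of_lt_one (r := (1 / 2 : ℝ)) (by norm_num)
        (by norm_num)).const_mul (Q.side / 2)
      rw [mul_zero] at h1
      refine h1.congr fun k => ?_
      simp only [q, dyadicCube]
      rw [one_div, inv_pow]; ring
    have hmem : ∀ k, x ∈ (q k).toSet := fun k =>
      Cube.halfOpen_subset _ (mem_dyadicCube_halfOpen.2 rfl)
    have ht := hx (fun k i => (q k).corner i + (q k).side / 2) (fun k => (q k).side / 2) hlim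
      (Eventually.of_forall fun k => by
        rw [one_mul, ← Cube.toSet_eq_closedBall]; exact hmem k)
    -- The averages over the dyadic cubes shrinking to `x` are all at most `c`, hence so is their
    -- limit `f x`.
    refine le_of_tendsto ht (Eventually.of_forall fun k => ?_)
    rw [← Cube.toSet_eq_closedBall, setAverage_eq, smul_eq_mul,
      inv_mul_le_iff₀ (Cube.volume_real_pos _), mul_comm]
    exact not_lt.1 (hnP k)

end CalderonZygmund

/-! ### The two implications for weights -/

section Weights

open Real (log posLog)

variable {n : ℕ}

/-- `e + u ≤ (e + 1) max(1, u) ≤ e² max(1, u)`. -/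
theorem log_exp_one_add_le {u : ℝ} (hu : 0 ≤ u) :
    log (Real.exp 1 + u) ≤ 2 + posLog u := by
  rw [Real.posLog_eq_log_max_one hu]
  have hm : (1 : ℝ) ≤ max 1 u := le_max_left _ _
  have he : 2 ≤ Real.exp 1 := by
    have := Real.add_one_le_exp 1
    linarith
  have h2 : Real.exp 2 = Real.exp 1 * Real.exp 1 := by rw [← Real.exp_add]; norm_num
  have h1 : Real.exp 1 + u ≤ Real.exp 2 * max 1 u := by
    have : u ≤ max 1 u := le_max_right _ _
    have h3 : Real.exp 1 + 1 ≤ Real.exp 2 := by rw [h2]; nlinarith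
    calc Real.exp 1 + u ≤ Real.exp 1 * max 1 u + 1 * max 1 u := by nlinarith
      _ = (Real.exp 1 + 1) * max 1 u := by ring
      _ ≤ _ := by gcongr
  calc log (Real.exp 1 + u) ≤ log (Real.exp 2 * max 1 u) := Real.log_le_log (by positivity) h1
    _ = 2 + log (max 1 u) := by
      rw [Real.log_mul (by positivity) (by positivity), Real.log_exp]

theorem posLog_le_log_exp_one_add {u : ℝ} (hu : 0 ≤ u) :
    posLog u ≤ log (Real.exp 1 + u) := by
  rw [Real.posLog_eq_log_max_one hu]
  have he : 2 ≤ Real.exp 1 := by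
    have := Real.add_one_le_exp 1
    linarith
  exact Real.log_le_log (by positivity) (max_le (by linarith) (by linarith))

theorem one_le_log_exp_one_add {u : ℝ} (hu : 0 ≤ u) : 1 ≤ log (Real.exp 1 + u) := by
  calc (1 : ℝ) = log (Real.exp 1) := (Real.log_exp 1).symm
    _ ≤ _ := Real.log_le_log (Real.exp_pos 1) (by linarith)

theorem posLog_le_self {x : ℝ} (hx : 0 ≤ x) : posLog x ≤ x :=
  max_le hx (Real.log_le_self hx)

theorem Weight.nonneg (w : Weight n) : 0 ≤ᵐ[volume] w.toFun := w.pos.mono fun _ h => h.le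

theorem Weight.nonneg_cube (w : Weight n) (Q : Cube n) : 0 ≤ᵐ[Q.vol] w.toFun :=
  ae_restrict_of_ae w.nonneg

theorem Weight.integral_pos (w : Weight n) (Q : Cube n) : 0 < ∫ x in Q.toSet, w.toFun x := by
  rw [integral_pos_iff_support_of_nonneg_ae (w.nonneg_cube Q) (w.integrable_cube Q)]
  have h : Function.support w.toFun =ᵐ[Q.vol] univ := by
    filter_upwards [ae_restrict_of_ae w.pos] with x hx
    exact eq_true (Function.mem_support.2 hx.ne')
  rw [measure_congr h, Measure.restrict_apply_univ]
  exact (ENNReal.toReal_pos_iff.1 Q.volume_real_pos).1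

theorem Weight.ofReal_setIntegral (w : Weight n) {Q : Cube n} {E : Set (Fin n → ℝ)}
    (hE : E ⊆ Q.toSet) :
    ENNReal.ofReal (∫ x in E, w.toFun x) = ∫⁻ x in E, ENNReal.ofReal (w.toFun x) :=
  ofReal_integral_eq_lintegral_ofReal ((w.integrable_cube Q).mono_measure
    (Measure.restrict_mono hE le_rfl)) (ae_restrict_of_ae w.nonneg)

theorem Cube.ofReal_volume_real (Q : Cube n) :
    ENNReal.ofReal (volume.real Q.toSet) = volume Q.toSet :=
  ENNReal.ofReal_toReal Q.volume_ne_top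

theorem KFun_restrict_pos (w : Weight n) (Q : Cube n) {t : ℝ} (ht : 0 < t)
    (htQ : t ≤ volume.real Q.toSet) : 0 < KFun (linftyToL1 Q.vol) t (w.restrict Q) := by
  have h := mul_integral_le_KFun (w.integrable_cube Q) ht.le
    (by rwa [measureReal_restrict_apply_univ])
  exact pos_of_mul_pos_right ((mul_pos ht (w.integral_pos Q)).trans_le h) measureReal_nonneg

theorem luxLLogL_condition_iff {f : (Fin n → ℝ) → ℝ} {Q : Cube n} {r : ℝ} :
    (volume Q.toSet)⁻¹ *
      ∫⁻ y in Q.toSet, ENNReal.ofReal (|f y| / r * Real.log (Real.exp 1 + |f y| / r)) ≤ 1 ↔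
    ∫⁻ y in Q.toSet, ENNReal.ofReal (|f y| / r * Real.log (Real.exp 1 + |f y| / r)) ≤
      ENNReal.ofReal (volume.real Q.toSet) := by
  rw [Q.ofReal_volume_real, ENNReal.inv_mul_le_iff _ Q.volume_ne_top, mul_one]
  exact (ENNReal.toReal_pos_iff.1 Q.volume_real_pos).1.ne'

/-- The inequality of `RH_{0,1}` at `t = |Q| / 2` bounds the Luxemburg norm by the average. -/
theorem luxLLogL_le_of_isRH01Const (w : Weight n) (Q : Cube n) {C : ℝ}
    (hC : IsRH01Const (linftyToL1 Q.vol) (w.restrict Q) C) :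
    luxLLogL w.toFun Q ≤
      ENNReal.ofReal (3 * C * ((volume.real Q.toSet)⁻¹ * ∫ x in Q.toSet, w.toFun x)) := by
  set V := volume.real Q.toSet with hV
  set A := ∫ x in Q.toSet, w.toFun x with hA
  have hV0 : 0 < V := Q.volume_real_pos
  have hA0 : 0 < A := w.integral_pos Q
  -- The definition only allows `t < |Q|`; half the volume is a convenient choice.
  have ht0 : 0 < V / 2 := by positivity
  have htι : V / 2 < ‖linftyToL1 Q.vol‖ := by rw [norm_linftyToL1_cube]; linarith
  have hC1 := one_le_of_isRH01Const hC ht0 htι (KFun_restrict_pos w Q ht0 (by linarith))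
  have hlog : ∫⁻ x in Q.toSet, ENNReal.ofReal
      (w.toFun x * posLog (V / 2 * w.toFun x / A)) ≤ ENNReal.ofReal (C * A) := by
    refine (le_lintegral_KFun (w.integrable_cube Q) (w.nonneg_cube Q) hA0 ht0).trans
      ((hC.2 _ ht0 htι).trans (ENNReal.ofReal_le_ofReal ?_))
    refine mul_le_mul_of_nonneg_left ((KFun_le_norm ht0.le).trans_eq ?_) hC.1.le
    exact norm_toL1_eq_integral (w.integrable_cube Q) (w.nonneg_cube Q)
  -- The `2` comes from `log(e + u) ≤ 2 + log⁺ u` and the `C` from `hlog`. Moreover `r ≥ 2 A / V`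
  -- gives `w / r ≤ (V / 2) w / A`, so the logarithm in `hlog` dominates.
  set r := (2 + C) * (V⁻¹ * A) with hr
  have hr0 : 0 < r := by positivity
  have hrA : r * V = (2 + C) * A := by rw [hr]; field_simp
  refine iInf₂_le_of_le r ⟨hr0, luxLLogL_condition_iff.2 ?_⟩ (ENNReal.ofReal_le_ofReal ?_)
  · calc ∫⁻ y in Q.toSet, ENNReal.ofReal
          (|w.toFun y| / r * log (Real.exp 1 + |w.toFun y| / r))
        ≤ ∫⁻ y in Q.toSet, ENNReal.ofReal r⁻¹ * (ENNReal.ofReal 2 * ENNReal.ofReal (w.toFun y) +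
            ENNReal.ofReal (w.toFun y * posLog (V / 2 * w.toFun y / A))) := by
          refine lintegral_mono_ae ?_
          filter_upwards [w.nonneg_cube Q] with y hy
          have hy' : 0 ≤ w.toFun y := hy
          have hu : 0 ≤ w.toFun y / r := by positivity
          have hmono : posLog (w.toFun y / r) ≤ posLog (V / 2 * w.toFun y / A) := by
            refine Real.posLog_le_posLog hu ?_
            rw [div_le_div_iff₀ hr0 hA0]
            have : A ≤ V / 2 * r := by nlinarith
            nlinarith
          have h1 := log_exp_one_add_le hu
          rw [abs_of_nonneg hy', ← ENNReal.ofReal_mul zero_le_two,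
            ← ENNReal.ofReal_add (by positivity) (mul_nonneg hy' Real.posLog_nonneg),
            ← ENNReal.ofReal_mul (by positivity)]
          refine ENNReal.ofReal_le_ofReal ?_
          calc w.toFun y / r * log (Real.exp 1 + w.toFun y / r)
              ≤ w.toFun y / r * (2 + posLog (V / 2 * w.toFun y / A)) := by gcongr; linarith
            _ = _ := by ring
      _ = ENNReal.ofReal r⁻¹ * (ENNReal.ofReal 2 * ENNReal.ofReal A +
            ∫⁻ y in Q.toSet, ENNReal.ofReal (w.toFun y * posLog (V / 2 * w.toFun y / A))) := by
          rw [lintegral_const_mul' _ _ ENNReal.ofReal_ne_top, lintegral_add_left',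
            lintegral_const_mul' _ _ ENNReal.ofReal_ne_top, hA, w.ofReal_setIntegral Subset.rfl]
          exact (w.integrable_cube Q).1.aemeasurable.ennreal_ofReal.const_mul _
      _ ≤ ENNReal.ofReal r⁻¹ * (ENNReal.ofReal 2 * ENNReal.ofReal A + ENNReal.ofReal (C * A)) := by
          gcongr
      _ = ENNReal.ofReal V := by
          rw [← ENNReal.ofReal_mul zero_le_two, ← ENNReal.ofReal_add (by positivity)
            (mul_nonneg hC.1.le hA0.le), ← ENNReal.ofReal_mul (by positivity)]
          congr 1
          rw [inv_mul_eq_iff_eq_mul₀ hr0.ne', hrA]; ring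
  · rw [hr]
    gcongr
    linarith

/-- Holds because `log(e + u) ≥ 1`; it forces the constants of `RH_{LLogL}` to be at least `1`. -/
theorem ofReal_average_le_luxLLogL (w : Weight n) (Q : Cube n) :
    ENNReal.ofReal ((volume.real Q.toSet)⁻¹ * ∫ x in Q.toSet, w.toFun x) ≤
      luxLLogL w.toFun Q := by
  refine le_iInf₂ fun r hr => ENNReal.ofReal_le_ofReal ?_
  have hr0 := hr.1
  have h := luxLLogL_condition_iff.1 hr.2
  have h1 : ENNReal.ofReal ((∫ x in Q.toSet, w.toFun x) * r⁻¹) ≤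
      ENNReal.ofReal (volume.real Q.toSet) := by
    refine le_trans ?_ h
    rw [ENNReal.ofReal_mul' (by positivity), w.ofReal_setIntegral Subset.rfl,
      ← lintegral_mul_const' _ _ ENNReal.ofReal_ne_top]
    refine lintegral_mono_ae ?_
    filter_upwards [w.nonneg_cube Q] with y hy
    have hy' : 0 ≤ w.toFun y := hy
    rw [← ENNReal.ofReal_mul hy', abs_of_nonneg hy', ← div_eq_mul_inv]
    exact ENNReal.ofReal_le_ofReal
      (le_mul_of_one_le_right (by positivity) (one_le_log_exp_one_add (by positivity)))
  rw [ENNReal.ofReal_le_ofReal_iff measureReal_nonneg, ← div_eq_mul_inv, div_le_iff₀ hr0] at h1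
  rwa [inv_mul_le_iff₀ Q.volume_real_pos]

theorem one_le_of_isRHLLogLConst {w : Weight n} {C : ℝ} (hC : IsRHLLogLConst w C) (Q : Cube n) :
    1 ≤ C := by
  have ha : 0 < (volume.real Q.toSet)⁻¹ * ∫ x in Q.toSet, w.toFun x :=
    mul_pos (inv_pos.2 Q.volume_real_pos) (w.integral_pos Q)
  have h := (ofReal_average_le_luxLLogL w Q).trans (hC.2 Q)
  rw [ENNReal.ofReal_le_ofReal_iff (mul_nonneg hC.1.le ha.le)] at h
  exact le_of_mul_le_mul_right (by simpa using h) ha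

/-- The logarithmic integral of the weight over a cube whose average is at most `2 ^ n` times the
reference height `c`. -/
theorem lintegral_mul_posLog_le {w : Weight n} {C : ℝ} (hC : IsRHLLogLConst w C) (Q : Cube n)
    {c : ℝ} (hc : 0 < c)
    (hQ : ∫ x in Q.toSet, w.toFun x ≤ 2 ^ n * c * volume.real Q.toSet) :
    ∫⁻ x in Q.toSet, ENNReal.ofReal (w.toFun x * posLog (w.toFun x / c)) ≤
      ENNReal.ofReal (4 * C + n) * ∫⁻ x in Q.toSet, ENNReal.ofReal (w.toFun x) := by
  have hC0 := hC.1
  have hl := hC.2 Q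
  set V := volume.real Q.toSet with hV
  set A := ∫ x in Q.toSet, w.toFun x with hA
  have hV0 : 0 < V := Q.volume_real_pos
  have hA0 : 0 < A := w.integral_pos Q
  -- The factor `2` gives strict inequality, hence an admissible `r` without attainment of the
  -- infimum.
  have hlt : luxLLogL w.toFun Q < ENNReal.ofReal (2 * C * (V⁻¹ * A)) := by
    refine hl.trans_lt ((ENNReal.ofReal_lt_ofReal_iff (by positivity)).2 ?_)
    have : 0 < C * (V⁻¹ * A) := by positivity
    linarith
  simp only [luxLLogL, iInf_lt_iff] at hlt
  obtain ⟨r, ⟨hr0, hr⟩, hrlt⟩ := hlt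
  have hr' := luxLLogL_condition_iff.1 hr
  have hrA : r < 2 * C * (V⁻¹ * A) := (ENNReal.ofReal_lt_ofReal_iff (by positivity)).1 hrlt
  have hrV : r * V ≤ 2 * C * A := by
    calc r * V ≤ 2 * C * (V⁻¹ * A) * V := by gcongr
      _ = _ := by field_simp
  -- The change of scale from `r` to `c` costs only the logarithm of `2 C · 2 ^ n`; the crude bound
  -- `log⁺ u ≤ u` keeps it linear in `C`.
  have hlog : posLog (r / c) ≤ 2 * C + n := by
    have h1 : r / c ≤ 2 * C * 2 ^ n := by
      rw [div_le_iff₀ hc]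
      refine le_of_mul_le_mul_right (hrV.trans ?_) hV0
      calc 2 * C * A ≤ 2 * C * (2 ^ n * c * V) := by gcongr
        _ = _ := by ring
    have h2 : posLog ((2 : ℝ) ^ n) ≤ n := by
      refine max_le (Nat.cast_nonneg n) ?_
      rw [Real.log_pow]
      have : log 2 ≤ 1 := by
        have := Real.log_le_sub_one_of_pos (x := 2) two_pos
        linarith
      nlinarith [Nat.cast_nonneg (α := ℝ) n]
    calc posLog (r / c) ≤ posLog (2 * C * 2 ^ n) := Real.posLog_le_posLog (by positivity) h1
      _ ≤ posLog (2 * C) + posLog (2 ^ n) := Real.posLog_mul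
      _ ≤ _ := add_le_add (posLog_le_self (by positivity)) h2
  calc ∫⁻ x in Q.toSet, ENNReal.ofReal (w.toFun x * posLog (w.toFun x / c))
      ≤ ∫⁻ x in Q.toSet, (ENNReal.ofReal (2 * C + n) * ENNReal.ofReal (w.toFun x) +
          ENNReal.ofReal r * ENNReal.ofReal
            (|w.toFun x| / r * log (Real.exp 1 + |w.toFun x| / r))) := by
        refine lintegral_mono_ae ?_
        filter_upwards [w.nonneg_cube Q] with x hx
        have hx' : 0 ≤ w.toFun x := hx
        have hu : 0 ≤ w.toFun x / r := by positivity
        have h1 := posLog_le_log_exp_one_add hu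
        have h2 : posLog (w.toFun x / c) ≤ posLog (w.toFun x / r) + posLog (r / c) := by
          have := Real.posLog_mul (x := w.toFun x / r) (y := r / c)
          rwa [div_mul_div_cancel₀ hr0.ne'] at this
        have h3 := one_le_log_exp_one_add hu
        rw [abs_of_nonneg hx', ← ENNReal.ofReal_mul (by positivity),
          ← ENNReal.ofReal_mul hr0.le, ← ENNReal.ofReal_add (by positivity) (by positivity)]
        refine ENNReal.ofReal_le_ofReal ?_
        calc w.toFun x * posLog (w.toFun x / c)
            ≤ w.toFun x * (log (Real.exp 1 + w.toFun x / r) + (2 * C + n)) := by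
              gcongr; linarith
          _ = _ := by field_simp; ring
    _ = ENNReal.ofReal (2 * C + n) * ENNReal.ofReal A + ENNReal.ofReal r *
          ∫⁻ x in Q.toSet, ENNReal.ofReal
            (|w.toFun x| / r * log (Real.exp 1 + |w.toFun x| / r)) := by
        rw [lintegral_add_left', lintegral_const_mul' _ _ ENNReal.ofReal_ne_top,
          lintegral_const_mul' _ _ ENNReal.ofReal_ne_top, hA, w.ofReal_setIntegral Subset.rfl]
        exact (w.integrable_cube Q).1.aemeasurable.ennreal_ofReal.const_mul _
    _ ≤ ENNReal.ofReal (2 * C + n) * ENNReal.ofReal A + ENNReal.ofReal r * ENNReal.ofReal V := by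
        gcongr
    _ ≤ ENNReal.ofReal (4 * C + n) * ENNReal.ofReal A := by
        rw [← ENNReal.ofReal_mul (by positivity), ← ENNReal.ofReal_mul (by positivity),
          ← ENNReal.ofReal_mul (by positivity), ← ENNReal.ofReal_add (by positivity)
          (by positivity)]
        exact ENNReal.ofReal_le_ofReal (by linarith)
    _ = _ := by rw [hA, w.ofReal_setIntegral Subset.rfl]

theorem isRH01Const_of_isRHLLogLConst {w : Weight n} {C : ℝ} (hC : IsRHLLogLConst w C)
    (Q : Cube n) :
    IsRH01Const (linftyToL1 Q.vol) (w.restrict Q) ((40 + 8 * n) * C) := by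
  have hC0 := hC.1
  have hC1 := one_le_of_isRHLLogLConst hC Q
  refine ⟨by positivity, fun t ht htι => ?_⟩
  rw [norm_linftyToL1_cube] at htι
  have hK := KFun_restrict_pos w Q ht htι.le
  -- Positivity of `K` makes a decomposition within a factor `2` of optimal available.
  obtain ⟨x₀, x₁, hdec, hsum⟩ := exists_decomposition_lt
    (show KFun (linftyToL1 Q.vol) t (w.restrict Q) < 2 * KFun (linftyToL1 Q.vol) t (w.restrict Q)
      by linarith)
  have hVA := mul_integral_le_KFun (w.integrable_cube Q) ht.le
    (by rw [measureReal_restrict_apply_univ]; exact htι.le)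
  rw [measureReal_restrict_apply_univ] at hVA
  change t * _ ≤ _ * KFun (linftyToL1 Q.vol) t (w.restrict Q) at hVA
  -- The `4` is twice the factor `2` lost in the decomposition: then `‖x₁‖ ≤ c / 2`, and the `L^∞`
  -- part can be absorbed when estimating `|Ω|`.
  have hT := lintegral_KFun_le (w.integrable_cube Q) (w.nonneg_cube Q)
    (c := 4 * KFun (linftyToL1 Q.vol) t (w.restrict Q) / t) (by positivity) ht
  change ∫⁻ s in Ioo 0 t, ENNReal.ofReal (KFun (linftyToL1 Q.vol) s (w.restrict Q) / s) ≤ _ at hT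
  generalize hKdef : KFun (linftyToL1 Q.vol) t (w.restrict Q) = K at *
  set c := 4 * K / t with hcdef
  have hc : 0 < c := by positivity
  have hct : c * t = 4 * K := by rw [hcdef]; field_simp
  have hQc : ∫ x in Q.toSet, w.toFun x ≤ c * volume.real Q.toSet := by
    refine le_of_mul_le_mul_left (hVA.trans ?_) ht
    calc volume.real Q.toSet * K ≤ volume.real Q.toSet * (4 * K) := by
          gcongr; linarith
      _ = _ := by rw [← hct]; ring
  obtain ⟨I, q, hsub, hdisj, hlow, hup, hout⟩ :=
    exists_calderonZygmund w.locallyIntegrable w.nonneg Q hQc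
  set Ω := ⋃ i, (q i).halfOpen with hΩdef
  have hΩm : MeasurableSet Ω := MeasurableSet.iUnion fun i => (q i).measurableSet_halfOpen
  have hΩQ : Ω ⊆ Q.toSet := iUnion_subset hsub
  have hΩtop : volume Ω ≠ ∞ := ((measure_mono hΩQ).trans_lt Q.volume_ne_top.lt_top).ne
  have hΩsum : ∀ g : (Fin n → ℝ) → ℝ≥0∞, ∫⁻ x in Ω, g x = ∑' i, ∫⁻ x in (q i).toSet, g x :=
    fun g => by
      rw [hΩdef, lintegral_iUnion (fun i => (q i).measurableSet_halfOpen) hdisj]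
      exact tsum_congr fun i => setLIntegral_congr (q i).halfOpen_ae_eq
  have hlowΩ : c * volume.real Ω ≤ ∫ x in Ω, w.toFun x := by
    have h : ENNReal.ofReal (c * volume.real Ω) ≤ ENNReal.ofReal (∫ x in Ω, w.toFun x) := by
      rw [w.ofReal_setIntegral hΩQ, hΩsum, ENNReal.ofReal_mul hc.le, Measure.real,
        ENNReal.ofReal_toReal hΩtop, ← setLIntegral_const, hΩsum]
      refine ENNReal.tsum_le_tsum fun i => ?_
      rw [setLIntegral_const, ← (q i).ofReal_volume_real, ← ENNReal.ofReal_mul hc.le,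
        ← w.ofReal_setIntegral Subset.rfl]
      exact ENNReal.ofReal_le_ofReal (hlow i).le
    exact (ENNReal.ofReal_le_ofReal_iff (integral_nonneg_of_ae (ae_restrict_of_ae w.nonneg))).1 h
  have hupΩ : ∫ x in Ω, w.toFun x ≤ 4 * K := by
    have h := setIntegral_le_of_decomposition (w.integrable_cube Q) hdec Ω
    rw [Measure.restrict_restrict hΩm, measureReal_restrict_apply hΩm,
      inter_eq_self_of_subset_left hΩQ] at h
    have hb : ‖x₁‖ * t ≤ 2 * K := by
      have := norm_nonneg x₀
      linarith
    have hv : volume.real Ω ≤ t := by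
      -- Here `c |Ω| ≤ ∫_Ω w ≤ 2 K + (c / 2) |Ω|`, so `c |Ω| ≤ 4 K = c t`, against `t < |Ω|`.
      by_contra! hv
      have h1 : ‖x₁‖ ≤ c / 2 := by
        refine le_of_mul_le_mul_right (hb.trans_eq ?_) ht
        linarith
      have h2 : ‖x₀‖ ≤ 2 * K := by
        have : 0 ≤ t * ‖x₁‖ := by positivity
        linarith
      nlinarith [mul_le_mul_of_nonneg_right h1 (measureReal_nonneg (μ := volume) (s := Ω))]
    have : ‖x₁‖ * volume.real Ω ≤ t * ‖x₁‖ := by rw [mul_comm]; gcongr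
    linarith
  have hlogQ : ∫⁻ x in Q.toSet, ENNReal.ofReal (w.toFun x * posLog (w.toFun x / c)) ≤
      ENNReal.ofReal (4 * C + n) * ENNReal.ofReal (4 * K) := by
    calc ∫⁻ x in Q.toSet, ENNReal.ofReal (w.toFun x * posLog (w.toFun x / c))
        = ∫⁻ x in Q.toSet, Ω.indicator
            (fun x => ENNReal.ofReal (w.toFun x * posLog (w.toFun x / c))) x := by
          refine lintegral_congr_ae ?_
          filter_upwards [ae_restrict_mem Q.measurableSet, ae_restrict_of_ae hout,
            w.nonneg_cube Q] with x hxQ hx hx0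
          by_cases hxΩ : x ∈ Ω
          · rw [indicator_of_mem hxΩ]
          · have hx0' : 0 ≤ w.toFun x := hx0
            have : posLog (w.toFun x / c) = 0 := by
              rw [Real.posLog_eq_zero_iff, abs_of_nonneg (by positivity)]
              exact (div_le_one hc).2 (hx hxQ hxΩ)
            rw [indicator_of_notMem hxΩ, this, mul_zero, ENNReal.ofReal_zero]
      _ = ∫⁻ x in Ω, ENNReal.ofReal (w.toFun x * posLog (w.toFun x / c)) := by
          rw [lintegral_indicator hΩm, Measure.restrict_restrict hΩm,
            inter_eq_self_of_subset_left hΩQ]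
      _ ≤ ENNReal.ofReal (4 * C + n) * ∫⁻ x in Ω, ENNReal.ofReal (w.toFun x) := by
          rw [hΩsum, hΩsum, ← ENNReal.tsum_mul_left]
          exact ENNReal.tsum_le_tsum fun i => lintegral_mul_posLog_le hC (q i) hc (hup i)
      _ ≤ _ := by
          rw [← w.ofReal_setIntegral hΩQ]
          gcongr
  calc ∫⁻ s in Ioo 0 t, ENNReal.ofReal (KFun (linftyToL1 Q.vol) s (w.restrict Q) / s)
      ≤ ENNReal.ofReal (2 * c * t) + ENNReal.ofReal 2 *
          (ENNReal.ofReal (4 * C + n) * ENNReal.ofReal (4 * K)) := by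
        refine hT.trans ?_
        gcongr
        simp_rw [ENNReal.ofReal_mul zero_le_two]
        rw [lintegral_const_mul' _ _ ENNReal.ofReal_ne_top]
        gcongr
    -- The sum is `8 K + 8 (4 C + n) K`; `C ≥ 1` turns it into a multiple of `C K`.
    _ ≤ ENNReal.ofReal ((40 + 8 * n) * C * K) := by
        rw [← ENNReal.ofReal_mul (by positivity), ← ENNReal.ofReal_mul (by positivity),
          ← ENNReal.ofReal_add (by positivity) (by positivity)]
        refine ENNReal.ofReal_le_ofReal ?_
        have h1 : K ≤ C * K := le_mul_of_one_le_left hK.le hC1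
        have h2 : (n : ℝ) * K ≤ n * (C * K) := by gcongr
        nlinarith

theorem isRHLLogLConst_of_supNormRH01_lt {w : Weight n} {C : ℝ}
    (h : supNormRH01 w < ENNReal.ofReal C) : IsRHLLogLConst w (3 * C) := by
  have hC : 0 < C := ENNReal.ofReal_pos.1 (bot_le.trans_lt h)
  refine ⟨by positivity, fun Q => luxLLogL_le_of_isRH01Const w Q ?_⟩
  have hQ : normRH01 (linftyToL1 Q.vol) (w.restrict Q) < ENNReal.ofReal C :=
    (le_iSup (fun Q : Cube n => normRH01 (linftyToL1 Q.vol) (w.restrict Q)) Q).trans_lt h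
  simp only [normRH01, iInf_lt_iff] at hQ
  obtain ⟨D, hD, hDC⟩ := hQ
  exact hD.mono ((ENNReal.ofReal_lt_ofReal_iff hC).1 hDC).le

theorem supNormRH01_le_of_isRHLLogLConst {w : Weight n} {C : ℝ} (hC : IsRHLLogLConst w C) :
    supNormRH01 w ≤ ENNReal.ofReal (40 + 8 * n) * ENNReal.ofReal C := by
  rw [← ENNReal.ofReal_mul (by positivity)]
  exact iSup_le fun Q => iInf₂_le _ (isRH01Const_of_isRHLLogLConst hC Q)

end Weights

end RHLimit

end

/-! ### Equivalence and comparison of the norms -/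

open RHLimit in
theorem mainTheorem3 (n : ℕ) (hn : 1 ≤ n) :
    (∀ w : Weight n, MemRHLLogL w ↔
      (∀ Q : Cube n, MemRH01 (linftyToL1 Q.vol) (w.restrict Q)) ∧ supNormRH01 w < ⊤) ∧
    ∃ c₁ c₂ : ℝ, 0 < c₁ ∧ 0 < c₂ ∧ ∀ w : Weight n,
      supNormRH01 w ≤ ENNReal.ofReal c₁ * normRHLLogL w ∧
      normRHLLogL w ≤ ENNReal.ofReal c₂ * supNormRH01 w := by
  refine ⟨fun w => ⟨?_, ?_⟩, 40 + 8 * n, 3, by positivity, by norm_num, fun w => ⟨?_, ?_⟩⟩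
  · rintro ⟨C, hC⟩
    exact ⟨fun Q => ⟨_, isRH01Const_of_isRHLLogLConst hC Q⟩,
      (supNormRH01_le_of_isRHLLogLConst hC).trans_lt
        (ENNReal.mul_lt_top ENNReal.ofReal_lt_top ENNReal.ofReal_lt_top)⟩
  · rintro ⟨-, h⟩
    obtain ⟨b, hb, -⟩ := ENNReal.lt_iff_exists_nnreal_btwn.1 h
    exact ⟨3 * b, isRHLLogLConst_of_supNormRH01_lt (by rwa [ENNReal.ofReal_coe_nnreal])⟩
  · have h40 : ENNReal.ofReal (40 + 8 * n) ≠ 0 := (ENNReal.ofReal_pos.2 (by positivity)).ne'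
    rw [← ENNReal.div_le_iff' h40 ENNReal.ofReal_ne_top]
    refine le_iInf₂ fun C hC => ?_
    rw [ENNReal.div_le_iff' h40 ENNReal.ofReal_ne_top]
    exact supNormRH01_le_of_isRHLLogLConst hC
  · have h3 : ENNReal.ofReal 3 ≠ 0 := by simp
    rw [← ENNReal.div_le_iff' h3 ENNReal.ofReal_ne_top]
    -- The supremum itself need not be known to be an admissible constant, so it is approached by
    -- real constants strictly above it.
    refine le_of_forall_gt_imp_ge_of_dense fun b hb => ?_
    obtain ⟨C, hC, hCb⟩ := ENNReal.lt_iff_exists_nnreal_btwn.1 hb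
    rw [ENNReal.div_le_iff' h3 ENNReal.ofReal_ne_top]
    refine (iInf₂_le _ (isRHLLogLConst_of_supNormRH01_lt (C := C)
      (by rwa [ENNReal.ofReal_coe_nnreal]))).trans ?_
    rw [ENNReal.ofReal_mul (by norm_num), ENNReal.ofReal_coe_nnreal]
    gcongr
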